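/- Let $H$ be a real or complex Hilbert space, let $a(\cdot,\cdot)$ be a bounded symmetric bilinear form on $H$, and call a bounded operator $S:H\to H$ $a(\cdot,\cdot)$-symmetric if for every $u\in H$ there is exactly one $v\in H$ with $a(w,v)=a(Sw,u)$ for all $w\in H$, and this $v$ is $Su$ (so $S$ need not be self-adjoint for the inner product of $H$). For subspaces $M,N\subset H$ let $$\delta(M,N)=\sup_{x\in M,\ \|x\|=1}\operatorname{dist}(x,N),\qquad \hat\delta(M,N)=\max(\delta(M,N),\delta(N,M)).$$ Let $T:H\to H$ be compact and $a(\cdot,\cdot)$-symmetric. For $0<h\le 1$ let $P_h:H\to H$ be a bounded projection onto a subspace $G_h\subset H$ that is $a(\cdot,\cdot)$-symmetric, and assume that $T_h:=P_hT$ converges to $T$ in operator norm as $h\to0$. Let $\mu\ne0$ be an eigenvalue of $T$ with eigenspace $M(\mu)=\{u\in H: Tu=\mu u\}$, and assume that $M(\mu)$ is also the generalized eigenspace of $T$ for $\mu$, i.e. the algebraic multiplicity of $\mu$ equals $\dim M(\mu)$. Let $\Gamma_\mu$ be a circle centred at $\mu$ such that the closed disc bounded by $\Gamma_\mu$ contains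 no other point of the spectrum $\sigma(T)$, and let $M_h(\mu)$ be the span of all eigenvectors of $T_h$ whose eigenvalues lie inside $\Gamma_\mu$. (If $H$ is real, then spectrum, eigenvalues and eigenvectors are taken over $\mathbb R$, and the disc is an interval.) Let $\mu_h$ be an eigenvalue of $T_h$, for all sufficiently small $h$, with $\mu_h\to\mu$ as $h\to0$. Then there is a constant $C$, independent of $h$, such that for all sufficiently small $h$ $$|\mu-\mu_h|\le C\,\hat\delta(M(\mu),M_h(\mu))^2 .$$ -/

import Mathlib

open Filter Topology

noncomputable section

namespace SpectralApprox

variable {𝕜 : Type*} [RCLike 𝕜] {H : Type*} [NormedAddCommGroup H] [InnerProductSpace 𝕜 H]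

/-- The adjoint of `S` with respect to the bounded bilinear form `a` exists: for every `u` there is
a unique `v` with `a(w, v) = a(S w, u)` for all `w`. -/
def HasFormAdjoint (a : H →L[𝕜] H →L[𝕜] 𝕜) (S : H →L[𝕜] H) : Prop :=
  ∀ u : H, ∃! v : H, ∀ w : H, a w v = a (S w) u

/-- The adjoint of `S` with respect to `a`, when it exists. -/
def formAdjoint (a : H →L[𝕜] H →L[𝕜] 𝕜) (S : H →L[𝕜] H) (hS : HasFormAdjoint a S) : H → H :=
  fun u => (hS u).choose

/-- `S` is `a(·,·)`-symmetric: its adjoint with respect to `a` exists and equals `S`. -/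
def IsFormSymmetric (a : H →L[𝕜] H →L[𝕜] 𝕜) (S : H →L[𝕜] H) : Prop :=
  ∃ hS : HasFormAdjoint a S, formAdjoint a S hS = S

/-- `δ(M, N) = sup { dist(x, N) : x ∈ M, ‖x‖ = 1 }` (a supremum of numbers in `[0, 1]`, which is
`0` if `M = 0`). -/
def oneSidedGap (M N : Submodule 𝕜 H) : ℝ :=
  sSup ((fun x : H => Metric.infDist x (N : Set H)) '' {x : H | x ∈ M ∧ ‖x‖ = 1})

/-- The gap `max (δ(M, N)) (δ(N, M))` between two subspaces. -/
def gap (M N : Submodule 𝕜 H) : ℝ :=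
  max (oneSidedGap M N) (oneSidedGap N M)

/-- The eigenspace `M(μ) = {u : T u = μ u}`. -/
def exactEigenspace (T : H →L[𝕜] H) (μ : 𝕜) : Submodule 𝕜 H :=
  Module.End.eigenspace (T : H →ₗ[𝕜] H) μ

/-- The span of all eigenvectors of `S` whose eigenvalues lie inside the circle of radius `r`
centred at `μ`. For `S = T_h` this is the approximating space `M_h(μ)`. -/
def approxEigenspace (S : H →L[𝕜] H) (μ : 𝕜) (r : ℝ) : Submodule 𝕜 H :=
  Submodule.span 𝕜
    {u : H | ∃ ν ∈ Metric.ball μ r, Module.End.HasEigenvector (S : H →ₗ[𝕜] H) ν u}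

end SpectralApprox

end

namespace SpectralApprox

section Lemmas

variable {𝕜 : Type*} [RCLike 𝕜] {H : Type*} [NormedAddCommGroup H] [InnerProductSpace 𝕜 H]

/-! Write `M` for the eigenspace, `N` for its approximation, and let `T_h uh = ν uh` with `uh ∈ N`.
For `u, m ∈ M` and `w ∈ N`, `(μ - ν) a(uh, w) = a((T - μ)(uh - u), m - w)`. With `u` close to `uh`
and `w` close to `m`, the right side is quadratic in the gap.

It remains to keep `a(uh, w)` away from zero. Uniqueness of form adjoints makes `a` nondegenerate on
`H`; since `H = range (T - μ) + M` and `a` vanishes on `range (T - μ) × M`, it is nondegenerate on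
the finite-dimensional `M`, hence uniformly so (`exists_form_lower_bound`). The estimate is
`norm_sub_le_of_gap_lt`. -/

theorem IsFormSymmetric.apply_left {a : H →L[𝕜] H →L[𝕜] 𝕜} {S : H →L[𝕜] H}
    (hS : IsFormSymmetric a S) (w u : H) : a (S w) u = a w (S u) := by
  obtain ⟨h, hSu⟩ := hS
  have key : a w (formAdjoint a S h u) = a (S w) u := (h u).choose_spec.1 w
  rw [← key, hSu]

/-- The existence of form adjoints makes the form nondegenerate. -/
theorem IsFormSymmetric.eq_zero_of_forall {a : H →L[𝕜] H →L[𝕜] 𝕜} {S : H →L[𝕜] H}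
    (hS : IsFormSymmetric a S) {z : H} (hz : ∀ w, a w z = 0) : z = 0 := by
  obtain ⟨h, -⟩ := hS
  exact (h 0).unique (fun w => by rw [hz, map_zero]) (fun w => by rw [map_zero, map_zero])

theorem bddAbove_infDist_image (M N : Submodule 𝕜 H) :
    BddAbove ((fun x : H => Metric.infDist x (N : Set H)) '' {x : H | x ∈ M ∧ ‖x‖ = 1}) := by
  refine ⟨1, ?_⟩
  rintro _ ⟨x, ⟨-, hx⟩, rfl⟩
  simpa [hx] using Metric.infDist_le_dist_of_mem (x := x) N.zero_mem

theorem oneSidedGap_nonneg (M N : Submodule 𝕜 H) : 0 ≤ oneSidedGap M N := by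
  apply Real.sSup_nonneg
  rintro _ ⟨x, -, rfl⟩
  exact Metric.infDist_nonneg

theorem exists_norm_sub_le_of_oneSidedGap_lt {M N : Submodule 𝕜 H} {η : ℝ}
    (hη : oneSidedGap M N < η) {x : H} (hx : x ∈ M) : ∃ y ∈ N, ‖x - y‖ ≤ η * ‖x‖ := by
  rcases eq_or_ne x 0 with rfl | hx0
  · exact ⟨0, N.zero_mem, by simp⟩
  have hn : ‖x‖ ≠ 0 := norm_ne_zero_iff.mpr hx0
  set c : 𝕜 := (‖x‖ : 𝕜) with hc
  have hc0 : c ≠ 0 := by simpa [hc] using hx0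
  have hcn : ‖c‖ = ‖x‖ := by simp [hc]
  have h1 : Metric.infDist (c⁻¹ • x) (N : Set H) < η := by
    refine lt_of_le_of_lt (le_csSup (bddAbove_infDist_image M N) ⟨c⁻¹ • x, ⟨?_, ?_⟩, rfl⟩) hη
    · exact M.smul_mem _ hx
    · rw [norm_smul, norm_inv, hcn, inv_mul_cancel₀ hn]
  obtain ⟨y, hy, hd⟩ := (Metric.infDist_lt_iff ⟨0, N.zero_mem⟩).mp h1
  refine ⟨c • y, N.smul_mem _ hy, ?_⟩
  have h2 : x - c • y = c • (c⁻¹ • x - y) := by rw [smul_sub, smul_inv_smul₀ hc0]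
  rw [h2, norm_smul, hcn, mul_comm, ← dist_eq_norm]
  exact mul_le_mul_of_nonneg_right hd.le (norm_nonneg _)

theorem mem_exactEigenspace {T : H →L[𝕜] H} {μ : 𝕜} {x : H} :
    x ∈ exactEigenspace T μ ↔ T x = μ • x :=
  Module.End.mem_eigenspace_iff

/-- For a semisimple nonzero eigenvalue of a compact operator, the eigenspace and the range of
`T - μ` span the whole space. -/
theorem exists_add_eq_of_isCompactOperator [CompleteSpace H] {T : H →L[𝕜] H}
    (hTc : IsCompactOperator T) {μ : 𝕜} (hμ0 : μ ≠ 0)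
    (hss : Module.End.maxGenEigenspace (T : H →ₗ[𝕜] H) μ = exactEigenspace T μ) (y : H) :
    ∃ x, ∃ m ∈ exactEigenspace T μ, y = (T x - μ • x) + m := by
  have hfin : FiniteDimensional 𝕜 (exactEigenspace T μ) :=
    ContinuousLinearMap.finite_dimensional_eigenspace hTc μ hμ0
  set M := exactEigenspace T μ
  set Q : H →L[𝕜] H := M.starProjection
  have hQM : ∀ x, Q x ∈ M := fun x => Submodule.starProjection_apply_mem M x
  have hQc : IsCompactOperator Q := by
    have hM' : LocallyCompactSpace M := by
      have := FiniteDimensional.proper_rclike 𝕜 M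
      infer_instance
    exact (isCompactOperator_of_locallyCompactSpace_dom M.orthogonalProjectionOnto).clm_comp
      M.subtypeL
  -- Fredholm alternative for `T + Q`. If `(T + Q) x = μ x`, then `(T - μ) x = -Q x ∈ M`, so `(T -
  -- μ)² x = 0`; semisimplicity puts `x` in `M`, and then `x = Q x = 0`.
  have hK : IsCompactOperator (T + Q : H →L[𝕜] H) := hTc.add hQc
  rcases hK.hasEigenvalue_or_mem_resolventSet hμ0 with h | h
  · exfalso
    obtain ⟨x, hx⟩ := h.exists_hasEigenvector
    have hx1 : T x + Q x = μ • x := hx.apply_eq_smul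
    have hTQ : T x - μ • x = - Q x := by rw [← hx1]; abel
    have hxM : x ∈ M := by
      rw [← hss, Module.End.mem_maxGenEigenspace]
      refine ⟨2, ?_⟩
      have h1 : ((T : H →ₗ[𝕜] H) - μ • 1) x = - Q x := hTQ
      have h2 : T (Q x) = μ • Q x := mem_exactEigenspace.mp (hQM x)
      rw [pow_two, Module.End.mul_apply, h1, map_neg]
      simp [h2]
    have hQx : Q x = x := Submodule.starProjection_eq_self_iff.mpr hxM
    rw [mem_exactEigenspace.mp hxM, hQx, sub_self] at hTQ
    exact hx.2 (neg_eq_zero.mp hTQ.symm)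
  · rw [spectrum.mem_resolventSet_iff] at h
    obtain ⟨R, hR⟩ := h.exists_right_inv
    refine ⟨-R y, -Q (R y), ?_, ?_⟩
    · exact M.neg_mem (hQM _)
    · have h1 := congrArg (fun L : H →L[𝕜] H => L y) hR
      simp only [mul_apply_eq_comp, sub_apply, add_apply, one_apply_eq_self,
        Algebra.algebraMap_eq_smul_one, smul_apply] at h1
      nth_rewrite 1 [← h1]
      rw [map_neg, smul_neg]
      abel

theorem apply_eq_zero_of_mem_exactEigenspace {a : H →L[𝕜] H →L[𝕜] 𝕜} {T : H →L[𝕜] H}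
    (hT : IsFormSymmetric a T) {μ : 𝕜} (x : H) {m : H} (hm : m ∈ exactEigenspace T μ) :
    a (T x - μ • x) m = 0 := by
  rw [map_sub, sub_apply, hT.apply_left, mem_exactEigenspace.mp hm]
  simp

/-- The form is uniformly nondegenerate on the eigenspace of a semisimple nonzero eigenvalue. -/
theorem exists_form_lower_bound [CompleteSpace H] {a : H →L[𝕜] H →L[𝕜] 𝕜}
    (ha : ∀ u v : H, a u v = a v u) {T : H →L[𝕜] H}
    (hTc : IsCompactOperator T) (hT : IsFormSymmetric a T) {μ : 𝕜} (hμ0 : μ ≠ 0)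
    (hss : Module.End.maxGenEigenspace (T : H →ₗ[𝕜] H) μ = exactEigenspace T μ) :
    ∃ c > 0, ∀ u ∈ exactEigenspace T μ, ∃ m ∈ exactEigenspace T μ,
      ‖m‖ ≤ 1 ∧ c * ‖u‖ ≤ ‖a u m‖ := by
  have hfin : FiniteDimensional 𝕜 (exactEigenspace T μ) :=
    ContinuousLinearMap.finite_dimensional_eigenspace hTc μ hμ0
  set M := exactEigenspace T μ
  let f : M →L[𝕜] M →L[𝕜] 𝕜 := a.bilinearComp M.subtypeL M.subtypeL
  have hf : LinearMap.ker (f : M →ₗ[𝕜] M →L[𝕜] 𝕜) = ⊥ := by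
    refine LinearMap.ker_eq_bot'.mpr fun u hu => Subtype.ext ?_
    refine hT.eq_zero_of_forall fun w => ?_
    obtain ⟨x, m, hm, rfl⟩ := exists_add_eq_of_isCompactOperator hTc hμ0 hss w
    have h1 : a (u : H) m = 0 := congrArg (fun L : M →L[𝕜] 𝕜 => L ⟨m, hm⟩) hu
    rw [map_add, add_apply, apply_eq_zero_of_mem_exactEigenspace hT x u.2,
      ha m, h1, add_zero]
  obtain ⟨K, hK0, hK⟩ := LinearMap.exists_antilipschitzWith _ hf
  have hK0' : (0 : ℝ) < K := hK0
  -- Halving `K⁻¹` makes the bound on `‖f u‖` strict, so some `m` in the unit ball realizes it.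
  refine ⟨(2 * K)⁻¹, by positivity, fun u hu => ?_⟩
  rcases eq_or_ne u 0 with rfl | hu0
  · exact ⟨0, M.zero_mem, by simp, by simp⟩
  have hun : 0 < ‖u‖ := norm_pos_iff.mpr hu0
  have h1 : ‖u‖ ≤ K * ‖f ⟨u, hu⟩‖ := by
    simpa using hK.le_mul_norm_sub ⟨u, hu⟩ 0
  have h2 : (2 * (K : ℝ))⁻¹ * ‖u‖ < ‖f ⟨u, hu⟩‖ := by
    rw [inv_mul_lt_iff₀ (by positivity)]
    nlinarith
  obtain ⟨m, hm1, hm2⟩ := ContinuousLinearMap.exists_lt_apply_of_lt_opNorm _ h2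
  exact ⟨m, m.2, hm1.le, hm2.le⟩

/-- The second-order estimate for one operator `S` satisfying the Galerkin orthogonality relation
`a((T - S) x, w) = 0` for `w ∈ N`. -/
theorem norm_sub_le_of_gap_lt {a : H →L[𝕜] H →L[𝕜] 𝕜} {T S : H →L[𝕜] H}
    (hT : IsFormSymmetric a T) {μ ν : 𝕜} {N : Submodule 𝕜 H}
    (hgal : ∀ x, ∀ w ∈ N, a (S x) w = a (T x) w) {c : ℝ} (hc : 0 < c)
    (hlow : ∀ u ∈ exactEigenspace T μ, ∃ m ∈ exactEigenspace T μ,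
      ‖m‖ ≤ 1 ∧ c * ‖u‖ ≤ ‖a u m‖)
    {uh : H} (huh : uh ∈ N) (hnorm : ‖uh‖ = 1) (heig : S uh = ν • uh) {η : ℝ}
    (hgap : gap (exactEigenspace T μ) N < η) (hη : η * (2 * (c + 2 * ‖a‖)) ≤ c) :
    ‖μ - ν‖ ≤ 2 * (‖a‖ * ‖T - μ • (1 : H →L[𝕜] H)‖) / c * η ^ 2 := by
  have hη0 : 0 < η := ((oneSidedGap_nonneg _ _).trans (le_max_left _ _)).trans_lt hgap
  obtain ⟨u, hu, huu⟩ :=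
    exists_norm_sub_le_of_oneSidedGap_lt ((le_max_right _ _).trans_lt hgap) huh
  rw [hnorm, mul_one] at huu
  obtain ⟨m, hm, hm1, hum⟩ := hlow u hu
  obtain ⟨w, hw, hmw⟩ :=
    exists_norm_sub_le_of_oneSidedGap_lt ((le_max_left _ _).trans_lt hgap) hm
  replace hmw : ‖m - w‖ ≤ η := hmw.trans (mul_le_of_le_one_right hη0.le hm1)
  set D := T - μ • (1 : H →L[𝕜] H) with hD
  have hDx : ∀ x, D x = T x - μ • x := fun x => rfl
  -- `D` kills `u`, `a(D uh, m) = 0` by symmetry of `T`, and Galerkin orthogonality turns `a(T uh,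
  -- w)` into `ν a(uh, w)`.
  have hid : (μ - ν) * a uh w = a (D (uh - u)) (m - w) := by
    have hDu : D u = 0 := by rw [hDx, mem_exactEigenspace.mp hu, sub_self]
    rw [map_sub D, hDu, sub_zero, map_sub, hDx, apply_eq_zero_of_mem_exactEigenspace hT uh hm,
      map_sub, sub_apply, ← hgal uh w hw, heig]
    simp only [map_smul, smul_apply, smul_eq_mul]
    ring
  have hup : ‖a (D (uh - u)) (m - w)‖ ≤ ‖a‖ * ‖D‖ * η ^ 2 := by
    calc ‖a (D (uh - u)) (m - w)‖ ≤ ‖a‖ * ‖D (uh - u)‖ * ‖m - w‖ := a.le_opNorm₂ _ _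
      _ ≤ ‖a‖ * (‖D‖ * η) * η := by
        gcongr
        exact (D.le_opNorm _).trans (by gcongr)
      _ = ‖a‖ * ‖D‖ * η ^ 2 := by ring
  -- Passing from `a u m` to `a uh w` costs `2‖a‖η`, and `‖u‖ ≥ 1 - η` costs `cη`; `hη` caps the
  -- total at `c / 2`.
  have hlo : c / 2 ≤ ‖a uh w‖ := by
    have h1 : a u m = a uh w - a (uh - u) m + a uh (m - w) := by
      simp only [map_sub, sub_apply]; ring
    have h2 : ‖a (uh - u) m‖ ≤ ‖a‖ * η := by
      calc ‖a (uh - u) m‖ ≤ ‖a‖ * ‖uh - u‖ * ‖m‖ := a.le_opNorm₂ _ _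
        _ ≤ ‖a‖ * η * 1 := by gcongr
        _ = ‖a‖ * η := mul_one _
    have h3 : ‖a uh (m - w)‖ ≤ ‖a‖ * η := by
      calc ‖a uh (m - w)‖ ≤ ‖a‖ * ‖uh‖ * ‖m - w‖ := a.le_opNorm₂ _ _
        _ ≤ ‖a‖ * 1 * η := by gcongr; exact hnorm.le
        _ = ‖a‖ * η := by rw [mul_one]
    have h4 : ‖a u m‖ ≤ ‖a uh w‖ + ‖a (uh - u) m‖ + ‖a uh (m - w)‖ := by
      rw [h1]
      exact (norm_add_le _ _).trans (by gcongr; exact norm_sub_le _ _)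
    have h5 : 1 - η ≤ ‖u‖ := by
      have := norm_sub_norm_le uh u
      rw [hnorm] at this
      linarith
    have h6 : c * (1 - η) ≤ c * ‖u‖ := by gcongr
    linarith
  have hfinal : ‖μ - ν‖ * (c / 2) ≤ ‖a‖ * ‖D‖ * η ^ 2 := by
    calc ‖μ - ν‖ * (c / 2) ≤ ‖μ - ν‖ * ‖a uh w‖ := by gcongr
      _ = ‖a (D (uh - u)) (m - w)‖ := by rw [← norm_mul, hid]
      _ ≤ _ := hup
  rw [div_mul_eq_mul_div, le_div_iff₀ hc]
  linarith

/-- An eigenvector for `ν ≠ 0` is `ν⁻¹ P (T u)`, hence in the range of `P`. This is what gives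
Galerkin orthogonality against the approximating space. -/
theorem approxEigenspace_le {P T : H →L[𝕜] H} {G : Submodule 𝕜 H}
    (hP : LinearMap.IsProj G (P : H →ₗ[𝕜] H)) {μ : 𝕜} {r : ℝ}
    (h0 : ∀ ν ∈ Metric.ball μ r, Module.End.HasEigenvalue (P.comp T : H →ₗ[𝕜] H) ν → ν ≠ 0) :
    approxEigenspace (P.comp T) μ r ≤ G := by
  refine Submodule.span_le.mpr ?_
  rintro u ⟨ν, hν, hu⟩
  have hν0 : ν ≠ 0 := h0 ν hν (Module.End.hasEigenvalue_of_hasEigenvector hu)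
  have h1 : P (T u) = ν • u := hu.apply_eq_smul
  have h2 : P (T u) ∈ G := hP.map_mem _
  rw [h1] at h2
  exact (G.smul_mem_iff hν0).mp h2

/-- If `0` is not in the spectrum of `T`, then it is not an eigenvalue of operators near `T`. -/
theorem eventually_not_hasEigenvalue_zero [CompleteSpace H] {ι : Type*} {l : Filter ι}
    {T : H →L[𝕜] H} {S : ι → H →L[𝕜] H} (hS : Tendsto S l (𝓝 T)) (h0 : (0 : 𝕜) ∉ spectrum 𝕜 T) :
    ∀ᶠ i in l, ¬ Module.End.HasEigenvalue (S i : H →ₗ[𝕜] H) (0 : 𝕜) := by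
  have hTu : IsUnit T := spectrum.zero_notMem_iff 𝕜 |>.mp h0
  filter_upwards [hS (Units.isOpen.mem_nhds hTu)] with i hi hev
  obtain ⟨R, hR⟩ := (show IsUnit (S i) from hi).exists_left_inv
  obtain ⟨x, hx⟩ := hev.exists_hasEigenvector
  have h1 : S i x = 0 := by simpa using hx.apply_eq_smul
  have h2 := congrArg (fun L : H →L[𝕜] H => L x) hR
  simp only [mul_apply_eq_comp, h1, map_zero, one_apply_eq_self] at h2
  exact hx.2 h2.symm

end Lemmas

end SpectralApprox

theorem mainTheorem7 {𝕜 : Type*} [RCLike 𝕜]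
    {H : Type*} [NormedAddCommGroup H] [InnerProductSpace 𝕜 H] [CompleteSpace H]
    -- a bounded symmetric bilinear form
    (a : H →L[𝕜] H →L[𝕜] 𝕜) (ha : ∀ u v : H, a u v = a v u)
    -- a compact, `a`-symmetric operator
    (T : H →L[𝕜] H) (hTc : IsCompactOperator T) (hT : SpectralApprox.IsFormSymmetric a T)
    -- bounded, `a`-symmetric projections `P h` onto subspaces `G h`, with `P h ∘ T → T` in norm
    (G : ℝ → Submodule 𝕜 H) (P : ℝ → H →L[𝕜] H)
    (hP : ∀ h ∈ Set.Ioc (0 : ℝ) 1, LinearMap.IsProj (G h) (P h : H →ₗ[𝕜] H))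
    (hPs : ∀ h ∈ Set.Ioc (0 : ℝ) 1, SpectralApprox.IsFormSymmetric a (P h))
    (hconv : Tendsto (fun h : ℝ => (P h).comp T) (𝓝[>] 0) (𝓝 T))
    -- a nonzero eigenvalue of `T`, whose generalized eigenspace is its eigenspace
    (μ : 𝕜) (hμ0 : μ ≠ 0) (hμ : Module.End.HasEigenvalue (T : H →ₗ[𝕜] H) μ)
    (hss : Module.End.maxGenEigenspace (T : H →ₗ[𝕜] H) μ = SpectralApprox.exactEigenspace T μ)
    -- a circle around `μ` that separates it from the rest of the spectrum
    (r : ℝ) (hr : 0 < r) (hΓ : spectrum 𝕜 T ∩ Metric.closedBall μ r = {μ})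
    -- eigenvalues of `P h ∘ T` that converge to `μ`
    (μh : ℝ → 𝕜)
    (hμh : ∀ᶠ h in 𝓝[>] (0 : ℝ), Module.End.HasEigenvalue ((P h).comp T : H →ₗ[𝕜] H) (μh h))
    (hμh_lim : Tendsto μh (𝓝[>] 0) (𝓝 μ)) :
    ∃ C : ℝ, ∃ h₀ ∈ Set.Ioc (0 : ℝ) 1, ∀ h : ℝ, 0 < h → h < h₀ →
      ‖μ - μh h‖ ≤ C * SpectralApprox.gap (SpectralApprox.exactEigenspace T μ)
        (SpectralApprox.approxEigenspace ((P h).comp T) μ r) ^ 2 := by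
  obtain ⟨c, hc, hlow⟩ := SpectralApprox.exists_form_lower_bound ha hTc hT hμ0 hss
  set ε : ℝ := c / (2 * (c + 2 * ‖a‖)) with hε
  have hden : 0 < 2 * (c + 2 * ‖a‖) := by positivity
  have hε0 : 0 < ε := by positivity
  set C₁ : ℝ := 2 * (‖a‖ * ‖T - μ • (1 : H →L[𝕜] H)‖) / c with hC₁
  have hC₁0 : 0 ≤ C₁ := by positivity
  have hball : ∀ᶠ h in 𝓝[>] (0 : ℝ), ∀ ν ∈ Metric.ball μ r,
      Module.End.HasEigenvalue ((P h).comp T : H →ₗ[𝕜] H) ν → ν ≠ 0 := by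
    by_cases h0 : (0 : 𝕜) ∈ spectrum 𝕜 T
    · refine Eventually.of_forall fun h ν hν _ hν0 => hμ0 ?_
      have : (0 : 𝕜) ∈ ({μ} : Set 𝕜) := hΓ ▸ ⟨h0, Metric.ball_subset_closedBall (hν0 ▸ hν)⟩
      exact (Set.mem_singleton_iff.mp this).symm
    · filter_upwards [SpectralApprox.eventually_not_hasEigenvalue_zero hconv h0]
        with h hh ν _ hev hν0
      exact hh (hν0 ▸ hev)
  have hev : ∀ᶠ h in 𝓝[>] (0 : ℝ), h ∈ Set.Ioc (0 : ℝ) 1 →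
      ‖μ - μh h‖ ≤ (C₁ + 1 / ε ^ 2) * SpectralApprox.gap (SpectralApprox.exactEigenspace T μ)
        (SpectralApprox.approxEigenspace ((P h).comp T) μ r) ^ 2 := by
    filter_upwards [hball, hμh, hμh_lim (Metric.ball_mem_nhds μ hr),
      hμh_lim (Metric.closedBall_mem_nhds μ one_pos)] with h h1 h2 h3 h4 hh
    replace h4 : ‖μ - μh h‖ ≤ 1 := by
      simpa [Metric.mem_closedBall, dist_eq_norm, norm_sub_rev] using h4
    set N := SpectralApprox.approxEigenspace ((P h).comp T) μ r with hN
    set g := SpectralApprox.gap (SpectralApprox.exactEigenspace T μ) N with hg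
    -- A gap of at least `ε` needs no spectral argument: the error is at most `1 ≤ g² / ε²`.
    rcases le_or_gt ε g with hge | hlt
    · have : 1 ≤ 1 / ε ^ 2 * g ^ 2 := by
        rw [one_div, inv_mul_eq_div, one_le_div (by positivity)]
        gcongr
      nlinarith [mul_nonneg hC₁0 (sq_nonneg g)]
    · obtain ⟨x, hx⟩ := h2.exists_hasEigenvector
      have hNG : N ≤ G h := SpectralApprox.approxEigenspace_le (hP h hh) h1
      have hgal : ∀ x, ∀ w ∈ N, a ((P h).comp T x) w = a (T x) w := by
        intro x w hw
        have hw' : P h w = w := (hP h hh).map_id w (hNG hw)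
        rw [ContinuousLinearMap.comp_apply, (hPs h hh).apply_left, hw']
      have hxn : ‖x‖ ≠ 0 := norm_ne_zero_iff.mpr hx.2
      have hxN : x ∈ N := Submodule.subset_span ⟨μh h, h3, hx⟩
      -- Distances to a subspace need not be attained, so the estimate is used for `η > g` and then
      -- `η → g`.
      have hbound : ∀ᶠ η in 𝓝[>] g, ‖μ - μh h‖ ≤ C₁ * η ^ 2 := by
        filter_upwards [Ioo_mem_nhdsGT hlt] with η hη
        refine SpectralApprox.norm_sub_le_of_gap_lt hT hgal hc hlow
          (uh := ((‖x‖ : 𝕜)⁻¹) • x) (N.smul_mem _ hxN) ?_ ?_ hη.1 ?_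
        · rw [norm_smul, norm_inv, RCLike.norm_coe_norm, inv_mul_cancel₀ hxn]
        · have hx1 : (P h).comp T x = μh h • x := hx.apply_eq_smul
          rw [map_smul, hx1, smul_comm]
        · exact ((lt_div_iff₀ hden).mp hη.2).le
      have hlim : Tendsto (fun η : ℝ => C₁ * η ^ 2) (𝓝[>] g) (𝓝 (C₁ * g ^ 2)) :=
        (Continuous.tendsto (by fun_prop) g).mono_left nhdsWithin_le_nhds
      refine (ge_of_tendsto hlim hbound).trans ?_
      rw [add_mul]
      exact le_add_of_nonneg_right (by positivity)
  obtain ⟨δ, hδ, hsub⟩ := mem_nhdsGT_iff_exists_Ioo_subset.mp hev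
  have hδ0 : (0 : ℝ) < δ := hδ
  refine ⟨C₁ + 1 / ε ^ 2, min δ 1, ⟨lt_min hδ0 one_pos, min_le_right _ _⟩, fun h h0 hlt => ?_⟩
  exact hsub ⟨h0, hlt.trans_le (min_le_left _ _)⟩ ⟨h0, (hlt.trans_le (min_le_right _ _)).le⟩
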